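/- Let $d\ge 2$, $n\ge 1$, $0\le t\le n$, $N=d^n$, $1\le f\le N$ and $m$ be integers. **The network.** The inverse Banyan network $\mathrm{BY}^{-1}(n)$ has $N$ inputs and $N$ outputs, both labelled by the strings in $\mathbb Z_d^n$, and $n$ stages of $d\times d$ switching elements (SEs); the SEs of each stage are labelled by the strings in $\mathbb Z_d^{n-1}$. Input $x$ is attached to the SE $x_1\cdots x_{n-1}$ of stage $1$, output $y$ to the SE $y_1\cdots y_{n-1}$ of stage $n$, and the SE $z_1\cdots z_{n-1}$ of stage $i\le n-1$ is linked to the $d$ SEs $z_1\cdots z_{i-1}*z_{i+1}\cdots z_{n-1}$ ($*\in\mathbb Z_d$) of stage $i+1$. Hence there is a unique route from every input to every output. The network $\log_d(N,0,m)$ consists of $m$ stacked copies (planes) of $\mathrm{BY}^{-1}(n)$ with common inputs and outputs. **Requests and the window algorithm.** An $f$-cast request is a pair $(a,B)$ of an input $a$ and a non-empty set $B$ of at most $f$ outputs. At any time each input and each output belongs to at most one request. The outputs are divided into $d^{n-t}$ windows of size $d^t$, a window being the set of all outputs with a given prefix of length $n-t$. The window algorithm with window size $d^t$ requires that, for each request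 $(a,B)$ and each window $W$, all branches from $a$ to $B\cap W$ are routed on one single plane (different windows may use the same or different planes). The crosstalk-free constraint requires that on no plane two routes of different requests share an SE. The network is *crosstalk-free $f$-cast nonblocking under the window algorithm with window size $d^t$* if, whenever the existing $f$-cast requests are routed according to the window algorithm and the crosstalk-free constraint, every new $f$-cast request from a free input to free outputs can also be routed according to both, without disturbing the existing connections. **Theorem.** Let $r=\lfloor\log_d f\rfloor$, $h=\left\lfloor\frac{r+n+1}{2}\right\rfloor$, $e=\left\lceil\frac{n-r-1}{2}\right\rceil$, and $$G(t,f)=\begin{cases} d^{n-t}[(n-t)(d-1)-1]+d^t-d^{2t-n-2}(d-1) & t>\frac n2,\ r\ge\max\{2t-n-2,\,n-t+1\}\\ f(d^{n-t-r}-1)+r d^{n-t}(d-1)-d^{n-t}+d^{h}+f(d^{n-h}-1) & t>\frac n2,\ r\le\min\{2t-n-3,\,n-t\}\\ d^{n-t}[(n-t)(d-1)-1]+d^{h}+f(d^{n-h}-1) & t>\frac n2,\ n-t+1\le r\le 2t-n-3\\ f(d^{n-t-r}-1)+d^{n-t}[r(d-1)-1]+d^{n-t-r}-1+d^t-d^{2t-n-2}(d-1)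 & t>\frac n2,\ 2t-n-2\le r\le n-t\\ d^{n-t}[(n-t)(d-1)-1]+d^t & t=\frac n2\\ f(d^{e}-1)+d^{n-e}-1 & t<\frac n2,\ r\le n-2t,\ f\le d^{n-2t}(d-1)\\ f(d^{t-1}-1)+d^{n-t-1}(d^2-d+1)-1 & t<\frac n2,\ r\le n-2t,\ f>d^{n-2t}(d-1)\\ f(d^{n-t-r}-1)+(2t-n+r)(d-1)d^{n-t}+d^{2n-3t-r}-1 & t<\frac n2,\ n-2t+1\le r\le n-t\\ t(d-1)d^{n-t}+d^{n-2t}-1 & t<\frac n2,\ n-t<r \end{cases}$$ (a rational number; $d^{2t-n-2}=1/d$ when $2t=n+1$). If $m\ge 1+G(t,f)$, then the network $\log_d(N,0,m)$ is crosstalk-free $f$-cast nonblocking under the window algorithm with window size $d^t$. -/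

import Mathlib

namespace Multilog

/-- Inputs and outputs of the inverse Banyan network `BY⁻¹(n)`: `d`-ary strings of length `n`.
Positions are numbered from `0`, so the symbol `x_{i+1}` of the string `x` is `x i`. -/
abbrev Terminal (d n : ℕ) : Type := Fin n → Fin d

/-- Labels of the `d × d` switching elements of one stage: `d`-ary strings of length `n - 1`. -/
abbrev SELabel (d n : ℕ) : Type := Fin (n - 1) → Fin d

/-- The label of the switching element to which a terminal is attached
(in the first stage for an input, in the last stage for an output):
its first `n - 1` symbols. -/
def attach {d n : ℕ} (x : Terminal d n) : SELabel d n :=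
  fun l => x (Fin.castLE (Nat.sub_le n 1) l)

/-- There is a link from the switching element `z` of stage `i` to the switching element `z'`
of the next stage iff the two labels agree except possibly at position `i`
(stages, like positions, are numbered from `0`). -/
def IsLink {d n : ℕ} (i : Fin n) (z z' : SELabel d n) : Prop :=
  ∀ l : Fin (n - 1), (l : ℕ) ≠ (i : ℕ) → z' l = z l

/-- `σ` is a route in `BY⁻¹(n)` from the input `x` to the output `y`: a path through the `n`
stages along links (`σ i` is the switching element visited in stage `i`), which starts at the
switching element of `x` and ends at the switching element of `y`. -/
def IsRoute {d n : ℕ} (x y : Terminal d n) (σ : Fin n → SELabel d n) : Prop :=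
  (∀ i : Fin n, (i : ℕ) = 0 → σ i = attach x) ∧
  (∀ i : Fin n, (i : ℕ) + 1 = n → σ i = attach y) ∧
  (∀ i j : Fin n, (j : ℕ) = (i : ℕ) + 1 → IsLink i (σ i) (σ j))

/-- The routes from `u` to `y` and from `u'` to `y'` in a `BY⁻¹(n)`-plane share a switching
element. -/
def SharesSE {d n : ℕ} (u y u' y' : Terminal d n) : Prop :=
  ∃ σ σ' : Fin n → SELabel d n, IsRoute u y σ ∧ IsRoute u' y' σ' ∧ ∃ i : Fin n, σ i = σ' i

/-- Routes exist and are unique: in stage `i` the first `i` symbols of the input's label have been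
replaced by those of the output's label. -/
theorem isRoute_iff {d n : ℕ} (x y : Terminal d n) (σ : Fin n → SELabel d n) :
    IsRoute x y σ ↔
      ∀ (i : Fin n) (l : Fin (n - 1)),
        σ i l = if (l : ℕ) < (i : ℕ) then attach y l else attach x l := by
  constructor
  · rintro ⟨h0, h1, h2⟩
    have hlow : ∀ (k : ℕ) (hk : k < n) (l : Fin (n - 1)), k ≤ (l : ℕ) →
        σ ⟨k, hk⟩ l = attach x l := by
      intro k
      induction k with
      | zero => intro hk l _; rw [h0 ⟨0, hk⟩ rfl]
      | succ k ih =>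
        intro hk l hl
        have hk' : k < n := by omega
        rw [h2 ⟨k, hk'⟩ ⟨k + 1, hk⟩ rfl l (by simp; omega)]
        exact ih hk' l (by omega)
    have hhigh : ∀ (e k : ℕ) (hk : k < n) (l : Fin (n - 1)), k + e + 1 = n → (l : ℕ) < k →
        σ ⟨k, hk⟩ l = attach y l := by
      intro e
      induction e with
      | zero => intro k hk l he _; rw [h1 ⟨k, hk⟩ (by simpa using he)]
      | succ e ih =>
        intro k hk l he hl
        have hk' : k + 1 < n := by omega
        rw [← h2 ⟨k, hk⟩ ⟨k + 1, hk'⟩ rfl l (by simp; omega)]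
        exact ih (k + 1) hk' l (by omega) (by omega)
    intro i l
    split_ifs with h
    · exact hhigh (n - 1 - i) i i.2 l (by omega) h
    · exact hlow i i.2 l (by omega)
  · intro h
    refine ⟨fun i hi => ?_, fun i hi => ?_, fun i j hij l hl => ?_⟩
    · ext l
      rw [h, if_neg (by omega)]
    · ext l
      have := l.2
      rw [h, if_pos (by omega)]
    · rw [h, h]
      by_cases hlt : (l : ℕ) < (i : ℕ)
      · rw [if_pos hlt, if_pos (by omega)]
      · rw [if_neg hlt, if_neg (by omega)]

/-- A state of the network `log_d(N, 0, m)`, `N = d ^ n`, formed by `m` stacked copies ("planes")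
of `BY⁻¹(n)`. Every output is either idle (`none`), or it is connected to an input `u` through
the plane `p` (`some (u, p)`). In particular every output belongs to at most one request. -/
abbrev State (d n m : ℕ) : Type := Terminal d n → Option (Terminal d n × Fin m)

/-- The outputs connected to the input `u`: if this set is non-empty, then `(u, dest S u)` is the
existing (multicast) request of `u`; otherwise `u` is free. -/
def dest {d n m : ℕ} (S : State d n m) (u : Terminal d n) : Finset (Terminal d n) :=
  Finset.univ.filter fun y => ∃ p : Fin m, S y = some (u, p)

/-- Every existing request is an `f`-cast request. -/
def FCast {d n m : ℕ} (f : ℕ) (S : State d n m) : Prop :=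
  ∀ u : Terminal d n, (dest S u).card ≤ f

/-- The crosstalk-free constraint: on no plane do routes of two different requests
share a switching element. (The branches of one multicast request do not block one another.) -/
def CrosstalkFree {d n m : ℕ} (S : State d n m) : Prop :=
  ∀ (y y' u u' : Terminal d n) (p : Fin m),
    S y = some (u, p) → S y' = some (u', p) → u ≠ u' → ¬ SharesSE u y u' y'

/-- Two outputs belong to the same window of size `d ^ t`:
they have the same prefix of length `n - t`. -/
def SameWindow {d n : ℕ} (t : ℕ) (y y' : Terminal d n) : Prop :=
  ∀ l : Fin n, (l : ℕ) < n - t → y l = y' l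

/-- The routing rule of the window algorithm with window size `d ^ t`: for every request and every
window, the part of the request that goes to this window is routed entirely on one plane. -/
def WindowRule {d n m : ℕ} (t : ℕ) (S : State d n m) : Prop :=
  ∀ (y y' u : Terminal d n) (p p' : Fin m),
    S y = some (u, p) → S y' = some (u, p') → SameWindow t y y' → p = p'

/-- The states that can occur in the crosstalk-free `f`-cast network under the window
algorithm with window size `d ^ t`. -/
def Admissible {d n m : ℕ} (f t : ℕ) (S : State d n m) : Prop :=
  FCast f S ∧ CrosstalkFree S ∧ WindowRule t S

/-- The state after the request `(a, B)` has been added to `S`, its branch to the output `y ∈ B`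
being routed on the plane `p y`; nothing else is changed. -/
def connect {d n m : ℕ} (S : State d n m) (a : Terminal d n) (B : Finset (Terminal d n))
    (p : Terminal d n → Fin m) : State d n m :=
  fun y => if y ∈ B then some (a, p y) else S y

/-- The network `log_d(d ^ n, 0, m)` is crosstalk-free `f`-cast nonblocking under the window
algorithm with window size `d ^ t`: whenever all existing requests are routed according to the
algorithm, every new `f`-cast request from a free input to free outputs can be routed according
to the algorithm without disturbing the existing connections. -/
def CrosstalkFreeNonblocking (d n m f t : ℕ) : Prop :=
  ∀ S : State d n m, Admissible f t S →
    ∀ (a : Terminal d n) (B : Finset (Terminal d n)),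
      dest S a = ∅ → B.Nonempty → B.card ≤ f → (∀ y ∈ B, S y = none) →
        ∃ p : Terminal d n → Fin m, Admissible f t (connect S a B p)

/-- The bound `G(t, f)` for given `d` and `n`, with `r = ⌊log_d f⌋`. All subtractions and
exponents are taken in `ℤ`; division by `2` of integers rounds down, thus
`h = ⌊(r + n + 1) / 2⌋` and `e = ⌊(n - r) / 2⌋ = ⌈(n - r - 1) / 2⌉`. -/
def G (d' n' t' f' : ℕ) : ℚ :=
  let d : ℚ := d'
  let f : ℚ := f'
  let n : ℤ := n'
  let t : ℤ := t'
  let r : ℤ := Nat.log d' f'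
  let h : ℤ := (r + n + 1) / 2
  let e : ℤ := (n - r) / 2
  if n < 2 * t then
    if max (2 * t - n - 2) (n - t + 1) ≤ r then
      d ^ (n - t) * ((n - t) * (d - 1) - 1) + d ^ t - d ^ (2 * t - n - 2) * (d - 1)
    else if r ≤ min (2 * t - n - 3) (n - t) then
      f * (d ^ (n - t - r) - 1) + r * d ^ (n - t) * (d - 1) - d ^ (n - t)
        + d ^ h + f * (d ^ (n - h) - 1)
    else if n - t + 1 ≤ r ∧ r ≤ 2 * t - n - 3 then
      d ^ (n - t) * ((n - t) * (d - 1) - 1) + d ^ h + f * (d ^ (n - h) - 1)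
    else -- here `2 * t - n - 2 ≤ r ≤ n - t`
      f * (d ^ (n - t - r) - 1) + d ^ (n - t) * (r * (d - 1) - 1)
        + d ^ (n - t - r) - 1 + d ^ t - d ^ (2 * t - n - 2) * (d - 1)
  else if n = 2 * t then
    d ^ (n - t) * ((n - t) * (d - 1) - 1) + d ^ t
  else -- here `2 * t < n`
    if r ≤ n - 2 * t ∧ f ≤ d ^ (n - 2 * t) * (d - 1) then
      f * (d ^ e - 1) + d ^ (n - e) - 1
    else if r ≤ n - 2 * t then
      f * (d ^ (t - 1) - 1) + d ^ (n - t - 1) * (d ^ 2 - d + 1) - 1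
    else if r ≤ n - t then
      f * (d ^ (n - t - r) - 1) + (2 * t - n + r) * (d - 1) * d ^ (n - t)
        + d ^ (2 * n - 3 * t - r) - 1
    else
      t * (d - 1) * d ^ (n - t) + d ^ (n - 2 * t) - 1

end Multilog

namespace Multilog

open Finset

/-! The windows met by a new request can be served independently, so the request fails only if every
plane is blocked for its part C in some window. One existing branch per plane that meets a branch to
C then gives m distinct outputs Y, and the window rule lets each input own at most one of them per
window (`exists_blocking`). It remains to show |Y| < 1 + G.

By `sharesSE_iff`, a meeting at stage i means that y shares i symbols with some b ∈ C while its
owner lies in the set `near a (i + 1)` of size d^(i+1): the farther an output is from C, the fewer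
owners are possible. Fix s ≤ q ≤ n - t. Owners in `near a s` account for at most f(d^s - 1) outputs.
Outputs of other owners that share exactly j symbols with C, s ≤ j < q, are counted by pairs (owner,
window), with a sum that telescopes (`card_le_add_farPart`). Those sharing q symbols are counted
directly or, for q = n - t, by a second split of the owners at a level h (`card_window_le_of_near`).
The cases of G are choices of s, q and h (`card_lt_one_add_G`). -/

/-! ### Sets of strings and their cardinalities -/

/-- The strings whose first `j` symbols are those of `c`. -/
def prefixSet {d n : ℕ} (c : Terminal d n) (j : ℕ) : Finset (Terminal d n) :=
  univ.filter fun y => ∀ l : Fin n, (l : ℕ) < j → y l = c l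

/-- The inputs whose routes can meet those of `a` as soon as the destinations agree in `i - 1`
symbols: `u` and `a` agree at all positions `l` with `i ≤ l + 1 < n`, and for `i = 0` also at the
last position. -/
def near {d n : ℕ} (a : Terminal d n) (i : ℕ) : Finset (Terminal d n) :=
  univ.filter fun u => ∀ l : Fin n, i ≤ ((l : ℕ) + 1) % n → u l = a l

theorem mem_prefixSet {d n : ℕ} {c y : Terminal d n} {j : ℕ} :
    y ∈ prefixSet c j ↔ ∀ l : Fin n, (l : ℕ) < j → y l = c l := by
  simp [prefixSet]

theorem mem_near {d n : ℕ} {a u : Terminal d n} {i : ℕ} :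
    u ∈ near a i ↔ ∀ l : Fin n, i ≤ ((l : ℕ) + 1) % n → u l = a l := by
  simp [near]

theorem self_mem_prefixSet {d n : ℕ} (c : Terminal d n) (j : ℕ) : c ∈ prefixSet c j :=
  mem_prefixSet.2 fun _ _ => rfl

theorem self_mem_near {d n : ℕ} (a : Terminal d n) (i : ℕ) : a ∈ near a i :=
  mem_near.2 fun _ _ => rfl

theorem prefixSet_anti {d n : ℕ} (c : Terminal d n) {i j : ℕ} (h : i ≤ j) :
    prefixSet c j ⊆ prefixSet c i := fun _ hy =>
  mem_prefixSet.2 fun l hl => mem_prefixSet.1 hy l (hl.trans_le h)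

theorem near_mono {d n : ℕ} (a : Terminal d n) {i j : ℕ} (h : i ≤ j) :
    near a i ⊆ near a j := fun _ hu =>
  mem_near.2 fun l hl => mem_near.1 hu l (h.trans hl)

theorem card_filter_agree {d n : ℕ} (c : Terminal d n) (K : Fin n → Prop) [DecidablePred K] :
    #(univ.filter fun x : Terminal d n => ∀ l, K l → x l = c l) =
      d ^ #(univ.filter fun l => ¬ K l) := by
  have : (univ.filter fun x : Terminal d n => ∀ l, K l → x l = c l) =
      Fintype.piFinset fun l => if K l then {c l} else univ := by
    ext x
    simp only [mem_filter, mem_univ, true_and, Fintype.mem_piFinset]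
    refine forall_congr' fun l => ?_
    by_cases h : K l <;> simp [h]
  rw [this, Fintype.card_piFinset, ← prod_const, prod_filter]
  refine prod_congr rfl fun l _ => ?_
  by_cases h : K l <;> simp [h]

theorem card_filter_fin (n : ℕ) (p : ℕ → Prop) [DecidablePred p] :
    #(univ.filter fun l : Fin n => p l) = #((range n).filter p) := by
  rw [← card_map Fin.valEmbedding]
  congr 1
  ext x
  simp only [mem_map, mem_filter, mem_univ, true_and, Fin.valEmbedding_apply, mem_range]
  constructor
  · rintro ⟨l, h, rfl⟩
    exact ⟨l.2, h⟩
  · rintro ⟨hx, h⟩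
    exact ⟨⟨x, hx⟩, h, rfl⟩

theorem card_prefixSet {d n : ℕ} (c : Terminal d n) (j : ℕ) :
    #(prefixSet c j) = d ^ (n - j) := by
  rw [prefixSet, card_filter_agree c fun l : Fin n => (l : ℕ) < j,
    card_filter_fin n fun l => ¬ l < j]
  congr 1
  rw [← Nat.card_Ico]
  congr 1
  ext x
  simp only [mem_filter, mem_range, mem_Ico]
  omega

theorem card_near {d n : ℕ} (a : Terminal d n) {i : ℕ} (hi : i ≤ n) :
    #(near a i) = d ^ i := by
  rw [near, card_filter_agree a fun l : Fin n => i ≤ ((l : ℕ) + 1) % n]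
  congr 1
  rcases n with _ | n
  · simp at hi
    simp [hi]
  have h := card_filter_fin (n + 1) fun l => l < i
  rw [show (range (n + 1)).filter (fun l => l < i) = range i by
    ext x; simp only [mem_filter, mem_range]; omega, card_range] at h
  refine Eq.trans ?_ h
  -- The cyclic shift l ↦ l + 1 carries the unconstrained positions to the first i ones.
  refine card_equiv (Equiv.addRight (1 : Fin (n + 1))) fun l => ?_
  simp [Fin.val_add]

/-- The window representatives whose first `j` symbols are those of `c`. -/
def windowSet {d n : ℕ} (c : Terminal d n) (k j : ℕ) : Finset (Terminal d n) :=
  univ.filter fun y => ∀ l : Fin n, ((l : ℕ) < j ∨ k ≤ (l : ℕ)) → y l = c l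

theorem card_windowSet {d n : ℕ} (c : Terminal d n) {k : ℕ} (hk : k ≤ n) (j : ℕ) :
    #(windowSet c k j) = d ^ (k - j) := by
  rw [windowSet, card_filter_agree c fun l : Fin n => (l : ℕ) < j ∨ k ≤ (l : ℕ),
    card_filter_fin n fun l => ¬ (l < j ∨ k ≤ l)]
  congr 1
  rw [← Nat.card_Ico]
  congr 1
  ext x
  simp only [mem_filter, mem_range, mem_Ico]
  omega

/-- The representative, with respect to `c`, of the window of `y`, the windows being given by
prefixes of length `k`. -/
def windowRep {d n : ℕ} (c : Terminal d n) (k : ℕ) (y : Terminal d n) : Terminal d n :=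
  fun l => if (l : ℕ) < k then y l else c l

theorem windowRep_eq_iff {d n t : ℕ} (c y y' : Terminal d n) :
    windowRep c (n - t) y = windowRep c (n - t) y' ↔ SameWindow t y y' := by
  constructor
  · intro h l hl
    simpa [windowRep, hl] using congrFun h l
  · intro h
    funext l
    by_cases hl : (l : ℕ) < n - t
    · simp [windowRep, hl, h l hl]
    · simp [windowRep, hl]

theorem windowRep_mem_windowSet {d n : ℕ} {c y : Terminal d n} {k j : ℕ} (hj : j ≤ k) :
    windowRep c k y ∈ windowSet c k j ↔ y ∈ prefixSet c j := by
  simp only [windowSet, mem_filter, mem_univ, true_and, mem_prefixSet, windowRep]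
  refine forall_congr' fun l => ?_
  by_cases h1 : (l : ℕ) < j
  · simp [h1, h1.trans_le hj]
  · by_cases h2 : (l : ℕ) < k
    · simp [h1, h2]
    · simp [h1, h2]

theorem windowSet_anti {d n : ℕ} (c : Terminal d n) (k : ℕ) {i j : ℕ} (h : i ≤ j) :
    windowSet c k j ⊆ windowSet c k i := fun y hy => by
  simp only [windowSet, mem_filter, mem_univ, true_and] at hy ⊢
  intro l hl
  exact hy l (hl.imp (fun h' => h'.trans_le h) id)

/-! ### Counting blocking outputs -/

/-- Outputs `y ∈ Y`, owned by the inputs `u y`, whose connections all block connections from `a` to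
the set `C` of outputs in one window; no input has two of them in one window, or more than `f` in
all. -/
structure Blocking {d n : ℕ} (t f : ℕ) (a : Terminal d n) (C Y : Finset (Terminal d n))
    (u : Terminal d n → Terminal d n) : Prop where
  ne : ∀ y ∈ Y, u y ≠ a
  conflict : ∀ y ∈ Y, ∃ b ∈ C, ∃ i < n, y ∈ prefixSet b i ∧ u y ∈ near a (i + 1)
  inj : ∀ y ∈ Y, ∀ y' ∈ Y, u y = u y' → SameWindow t y y' → y = y'
  card_le : ∀ v, #(Y.filter fun y => u y = v) ≤ f
  disjoint : Disjoint Y C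
  window : ∀ b ∈ C, ∀ b' ∈ C, SameWindow t b b'

/-- The blocking outputs that share a prefix of length `q` with `c` and are not owned by an input in
`near a s`. -/
def farPart {d n : ℕ} (a c : Terminal d n) (Y : Finset (Terminal d n))
    (u : Terminal d n → Terminal d n) (s q : ℕ) : Finset (Terminal d n) :=
  Y.filter fun y => y ∈ prefixSet c q ∧ u y ∉ near a s

namespace Blocking

variable {d n t f : ℕ} {a c : Terminal d n} {C Y : Finset (Terminal d n)}
  {u : Terminal d n → Terminal d n}

/-- All of C agrees with c in n - t > j symbols, so a meeting at a stage beyond j would force y to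
share j + 1 symbols with c. -/
theorem mem_near_succ (H : Blocking t f a C Y u) (hc : c ∈ C) {y : Terminal d n} (hy : y ∈ Y)
    {j : ℕ} (hj : j < n - t) (hyj : y ∉ prefixSet c (j + 1)) : u y ∈ near a (j + 1) := by
  obtain ⟨b, hb, i, -, hyb, hu⟩ := H.conflict y hy
  refine near_mono a ?_ hu
  by_contra! hlt
  refine hyj (mem_prefixSet.2 fun l hl => ?_)
  rw [mem_prefixSet.1 hyb l (by omega), H.window b hb c hc l (by omega)]

/-- Only d^s - 1 owners are possible, since a owns nothing in Y. -/
theorem card_owned_le (H : Blocking t f a C Y u) {s : ℕ} (hs : s ≤ n) :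
    #(Y.filter fun y => u y ∈ near a s) ≤ (d ^ s - 1) * f := by
  rw [← card_near a hs, ← card_erase_of_mem (self_mem_near a s), mul_comm]
  refine card_le_mul_card_image_of_maps_to (f := u) (fun y hy => ?_) f fun v _ => ?_
  · rw [mem_filter] at hy
    exact mem_erase.2 ⟨H.ne y hy.1, hy.2⟩
  · exact (card_le_card (filter_subset_filter _ (filter_subset _ _))).trans (H.card_le v)

/-- An element of Y is determined by its owner and its window. The first factor counts the owners
available at level j, the second the windows sharing j but not j + 1 symbols with c. -/
theorem card_level_le (H : Blocking t f a C Y u) (hc : c ∈ C) {s j : ℕ} (hsj : s ≤ j)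
    (hj : j < n - t) :
    #(farPart a c Y u s j \ farPart a c Y u s (j + 1)) ≤
      (d ^ (j + 1) - d ^ s) * (d ^ (n - t - j) - d ^ (n - t - (j + 1))) := by
  rw [← card_near a (show j + 1 ≤ n by omega), ← card_near a (show s ≤ n by omega),
    ← card_windowSet c (Nat.sub_le n t), ← card_windowSet c (Nat.sub_le n t),
    ← card_sdiff_of_subset (near_mono a (show s ≤ j + 1 by omega)),
    ← card_sdiff_of_subset (windowSet_anti c _ (Nat.le_succ j)), ← card_product]
  refine card_le_card_of_injOn (fun y => (u y, windowRep c (n - t) y)) (fun y hy => ?_)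
    fun y hy y' hy' h => ?_
  · simp only [farPart, coe_sdiff, coe_filter, Set.mem_sdiff, Set.mem_ofPred_eq, not_and,
      not_not] at hy
    obtain ⟨⟨hY, hyj, hs⟩, hn⟩ := hy
    have hyj' : y ∉ prefixSet c (j + 1) := fun h => hs (hn hY h)
    simp only [coe_product, Set.mem_prod, mem_coe, mem_sdiff]
    exact ⟨⟨H.mem_near_succ hc hY hj hyj', hs⟩, (windowRep_mem_windowSet hj.le).2 hyj,
      fun h => hyj' ((windowRep_mem_windowSet hj).1 h)⟩
  · simp only [farPart, coe_sdiff, coe_filter, Set.mem_sdiff, Set.mem_ofPred_eq] at hy hy'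
    simp only [Prod.mk.injEq] at h
    exact H.inj y hy.1.1 y' hy'.1.1 h.1 ((windowRep_eq_iff c y y').1 h.2)

/-- An output that departs from c within the first s symbols has its owner in `near a s`, so the
prefix condition is automatic. -/
theorem farPart_self (H : Blocking t f a C Y u) (hc : c ∈ C) {s : ℕ} (hs : s ≤ n - t) :
    farPart a c Y u s s = Y.filter fun y => u y ∉ near a s := by
  refine filter_congr fun y hy => and_iff_right_of_imp fun h => ?_
  rcases s with _ | s
  · simp [mem_prefixSet]
  · by_contra hy'
    exact h (H.mem_near_succ hc hy hs hy')

/-- The count of blocking outputs, up to those which share a prefix of length `q` with `c`. -/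
theorem card_le_add_farPart (H : Blocking t f a C Y u) (hc : c ∈ C) (hd : 1 ≤ d) (s i : ℕ)
    (hq : s + i ≤ n - t) :
    (#Y : ℚ) ≤ f * ((d : ℚ) ^ s - 1) + i * (d - 1) * d ^ (n - t) - d ^ (n - t)
      + d ^ (n - t - i) + #(farPart a c Y u s (s + i)) := by
  induction i with
  | zero =>
    have h1 := H.card_owned_le (s := s) (by omega)
    have h2 := card_filter_add_card_filter_not (s := Y) (fun y => u y ∈ near a s)
    rw [add_zero, H.farPart_self hc (by omega)]
    have h3 : ((#(Y.filter fun y => u y ∈ near a s) : ℕ) : ℚ) ≤ ((d : ℚ) ^ s - 1) * f := by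
      refine (Nat.cast_le.2 h1).trans_eq ?_
      rw [Nat.cast_mul, Nat.cast_sub (Nat.one_le_pow _ _ hd)]
      simp
    have h4 : (#Y : ℚ) = (#(Y.filter fun y => u y ∈ near a s) : ℕ)
        + (#(Y.filter fun y => u y ∉ near a s) : ℕ) := by
      rw [← h2]; push_cast; rfl
    simp
    linarith
  | succ i ih =>
    have h1 := ih (by omega)
    have h2 := H.card_level_le hc (s := s) (j := s + i) (by omega) (by omega)
    have h3 := card_le_card_sdiff_add_card (s := farPart a c Y u s (s + i))
      (t := farPart a c Y u s (s + i + 1))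
    obtain ⟨k, hk⟩ : ∃ k, n - t = s + i + 1 + k := ⟨n - t - (s + i + 1), by omega⟩
    have h4 : ((#(farPart a c Y u s (s + i)) : ℕ) : ℚ) ≤
        ((d : ℚ) ^ (s + i + 1) - d ^ s) * (d ^ (k + 1) - d ^ k)
          + #(farPart a c Y u s (s + i + 1)) := by
      have h5 := h3.trans (Nat.add_le_add_right h2 _)
      rw [hk, show s + i + 1 + k - (s + i) = k + 1 by omega,
        show s + i + 1 + k - (s + i + 1) = k by omega] at h5
      refine (Nat.cast_le.2 h5).trans_eq ?_
      rw [Nat.cast_add, Nat.cast_mul, Nat.cast_sub (Nat.pow_le_pow_right hd (by omega)),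
        Nat.cast_sub (Nat.pow_le_pow_right hd (by omega))]
      push_cast
      ring
    rw [hk, show s + i + 1 + k - i = s + k + 1 by omega] at h1
    rw [hk, show s + i + 1 + k - (i + 1) = s + k by omega, ← add_assoc]
    push_cast
    refine h1.trans ?_
    -- Each level costs (d - 1)d^(n-t) up to a correction that telescopes.
    have : ((d : ℚ) ^ (s + i + 1) - d ^ s) * (d ^ (k + 1) - d ^ k) =
      (d - 1) * d ^ (s + i + 1 + k) - (d ^ (s + k + 1) - d ^ (s + k)) := by ring
    linarith

theorem card_farPart_le (H : Blocking t f a C Y u) (hc : c ∈ C) (hd : 1 ≤ d) (s q : ℕ) :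
    (#(farPart a c Y u s q) : ℚ) ≤ (d : ℚ) ^ (n - q) - 1 := by
  have h : #(farPart a c Y u s q) ≤ d ^ (n - q) - 1 := by
    rw [← card_prefixSet c q, ← card_erase_of_mem (self_mem_prefixSet c q)]
    refine card_le_card fun y hy => ?_
    rw [farPart, mem_filter] at hy
    exact mem_erase.2 ⟨fun h => disjoint_left.1 H.disjoint hy.1 (h ▸ hc), hy.2.1⟩
  refine (Nat.cast_le.2 h).trans_eq ?_
  rw [Nat.cast_sub (Nat.one_le_pow _ _ hd)]
  simp

theorem card_window_le (H : Blocking t f a C Y u) (hc : c ∈ C) (ht : t ≤ n) (s : ℕ) :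
    (#(farPart a c Y u s (n - t)) : ℚ) ≤ (d : ℚ) ^ t - #C := by
  have h : #(farPart a c Y u s (n - t)) + #C ≤ d ^ t := by
    rw [← show n - (n - t) = t by omega, ← card_prefixSet c (n - t),
      ← card_union_of_disjoint, show n - (n - (n - t)) = n - t by omega]
    · refine card_le_card (union_subset (fun y hy => ?_) fun b hb => ?_)
      · rw [farPart, mem_filter] at hy
        exact hy.2.1
      · exact mem_prefixSet.2 (H.window b hb c hc)
    · exact H.disjoint.mono_left (filter_subset _ _)
  have h' : ((#(farPart a c Y u s (n - t)) : ℚ) + #C ≤ (d : ℚ) ^ t) := by exact_mod_cast h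
  linarith

/-- Within a single window distinct outputs have distinct owners, which bounds those owned in `near
a h`. Any other output meets its branch at stage h or later, hence shares h symbols with some b ∈ C.
-/
theorem card_window_le_of_near (H : Blocking t f a C Y u) (hd : 1 ≤ d) {s h : ℕ}
    (hs : s ≤ h) (hh : h ≤ n) :
    (#(farPart a c Y u s (n - t)) : ℚ) ≤ (d : ℚ) ^ h - d ^ s + #C * ((d : ℚ) ^ (n - h) - 1) := by
  have h1 : #((farPart a c Y u s (n - t)).filter fun y => u y ∈ near a h) ≤ d ^ h - d ^ s := by
    rw [← card_near a hh, ← card_near a (hs.trans hh),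
      ← card_sdiff_of_subset (near_mono a hs)]
    refine card_le_card_of_injOn u (fun y hy => ?_) fun y hy y' hy' he => ?_
    · simp only [farPart, coe_filter, mem_filter, Set.mem_ofPred_eq] at hy
      simp only [mem_coe, mem_sdiff]
      exact ⟨hy.2, hy.1.2.2⟩
    · simp only [farPart, coe_filter, mem_filter, Set.mem_ofPred_eq, mem_prefixSet] at hy hy'
      exact H.inj y hy.1.1 y' hy'.1.1 he fun l hl =>
        (hy.1.2.1 l hl).trans (hy'.1.2.1 l hl).symm
  have h2 : #((farPart a c Y u s (n - t)).filter fun y => u y ∉ near a h) ≤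
      #C * (d ^ (n - h) - 1) := by
    refine (card_le_card (t := C.biUnion fun b => (prefixSet b h).erase b) fun y hy => ?_).trans
      (card_biUnion_le_card_mul _ _ _ fun b _ => ?_)
    · simp only [farPart, mem_filter] at hy
      obtain ⟨b, hb, i, -, hyb, hu⟩ := H.conflict y hy.1.1
      refine mem_biUnion.2 ⟨b, hb, mem_erase.2
        ⟨fun h => disjoint_left.1 H.disjoint hy.1.1 (h ▸ hb), prefixSet_anti b ?_ hyb⟩⟩
      by_contra! hlt
      exact hy.2 (near_mono a hlt hu)
    · rw [card_erase_of_mem (self_mem_prefixSet b h), card_prefixSet]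
  have h3 := card_filter_add_card_filter_not (s := farPart a c Y u s (n - t))
    (fun y => u y ∈ near a h)
  have h4 := (Nat.cast_le (α := ℚ)).2 (h3.symm.le.trans (Nat.add_le_add h1 h2))
  rw [Nat.cast_add, Nat.cast_mul, Nat.cast_sub (Nat.pow_le_pow_right hd hs),
    Nat.cast_sub (Nat.one_le_pow _ _ hd)] at h4
  simpa using h4

end Blocking

/-! ### Crosstalk and the reduction to blocking sets -/

/-- At stage i the label on a route consists of the first i symbols of the output and the symbols of
the input from position i on, without the last. -/
theorem sharesSE_iff {d n : ℕ} {u y a b : Terminal d n} :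
    SharesSE u y a b ↔ ∃ i < n, y ∈ prefixSet b i ∧ u ∈ near a (i + 1) := by
  have hnear : ∀ i, u ∈ near a (i + 1) ↔ ∀ l : Fin n, i ≤ (l : ℕ) → (l : ℕ) + 1 < n → u l = a l := by
    intro i
    rw [mem_near]
    refine forall_congr' fun l => ?_
    -- At the last position (l + 1) % n = 0, so `near a (i + 1)` leaves it free, as labels do.
    rcases (show (l : ℕ) + 1 ≤ n from l.2).lt_or_eq with h | h
    · simp [Nat.mod_eq_of_lt h, h]
    · simp [h]
  constructor
  · rintro ⟨σ, σ', h, h', i, hi⟩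
    rw [isRoute_iff] at h h'
    refine ⟨i, i.2, mem_prefixSet.2 fun l hl => ?_, (hnear i).2 fun l hl hl' => ?_⟩
    · have hl' : (l : ℕ) < n - 1 := by omega
      have := congrFun hi ⟨l, hl'⟩
      rw [h, h', if_pos hl, if_pos hl] at this
      exact this
    · have := congrFun hi ⟨l, by omega⟩
      rw [h, h', if_neg (by simpa using hl), if_neg (by simpa using hl)] at this
      exact this
  · rintro ⟨i, hi, hy, hu⟩
    refine ⟨fun i l => if (l : ℕ) < (i : ℕ) then attach y l else attach u l,
      fun i l => if (l : ℕ) < (i : ℕ) then attach b l else attach a l,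
      (isRoute_iff _ _ _).2 fun _ _ => rfl, (isRoute_iff _ _ _).2 fun _ _ => rfl, ⟨i, hi⟩, ?_⟩
    funext l
    have hl := l.2
    by_cases h : (l : ℕ) < i
    · simpa [h, attach] using mem_prefixSet.1 hy _ h
    · simpa [h, attach] using (hnear i).1 hu (Fin.castLE (Nat.sub_le n 1) l)
        (by simpa using h) (by simp; omega)

theorem SharesSE.symm {d n : ℕ} {u y u' y' : Terminal d n} (h : SharesSE u y u' y') :
    SharesSE u' y' u y :=
  let ⟨σ, σ', h1, h2, i, hi⟩ := h
  ⟨σ', σ, h2, h1, i, hi.symm⟩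

theorem mem_dest {d n m : ℕ} {S : State d n m} {u y : Terminal d n} :
    y ∈ dest S u ↔ ∃ p, S y = some (u, p) := by
  simp [dest]

theorem ne_of_dest_eq_empty {d n m : ℕ} {S : State d n m} {a u y : Terminal d n} {p : Fin m}
    (ha : dest S a = ∅) (h : S y = some (u, p)) : u ≠ a := by
  rintro rfl
  exact notMem_empty y (ha ▸ mem_dest.2 ⟨p, h⟩)

/-- If every plane is blocked for a window then there is a blocking set of `m` outputs. -/
theorem exists_blocking {d n m f t : ℕ} {S : State d n m} (hS : Admissible f t S)
    {a : Terminal d n} {C : Finset (Terminal d n)} (ha : dest S a = ∅)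
    (hC : ∀ y ∈ C, S y = none) (hw : ∀ b ∈ C, ∀ b' ∈ C, SameWindow t b b')
    (hblock : ∀ p : Fin m, ∃ b ∈ C, ∃ u y, S y = some (u, p) ∧ SharesSE u y a b) :
    ∃ Y u, Blocking t f a C Y u ∧ #Y = m := by
  choose b hb v y hy hs using hblock
  have hinj : Function.Injective y := fun p p' h => by
    have h1 := hy p
    rw [h, hy p'] at h1
    simpa using (congrArg Prod.snd (Option.some.inj h1)).symm
  -- The default a is never used: every output in Y is busy.
  set u : Terminal d n → Terminal d n := fun z => ((S z).map Prod.fst).getD a with hu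
  have huy : ∀ p, u (y p) = v p := fun p => by simp [hu, hy p]
  refine ⟨univ.image y, u, ⟨?_, ?_, ?_, ?_, ?_, hw⟩, ?_⟩
  · simp only [mem_image, mem_univ, true_and, forall_exists_index, forall_apply_eq_imp_iff, huy]
    exact fun p => ne_of_dest_eq_empty ha (hy p)
  · simp only [mem_image, mem_univ, true_and, forall_exists_index, forall_apply_eq_imp_iff, huy]
    exact fun p => ⟨b p, hb p, sharesSE_iff.1 (hs p)⟩
  · simp only [mem_image, mem_univ, true_and, forall_exists_index, forall_apply_eq_imp_iff, huy]
    intro p p' h hsw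
    rw [hS.2.2 _ _ _ _ _ (hy p) (h ▸ hy p') hsw]
  · refine fun w => (card_le_card fun z hz => ?_).trans (hS.1 w)
    simp only [mem_filter, mem_image, mem_univ, true_and] at hz
    obtain ⟨⟨p, rfl⟩, h⟩ := hz
    exact mem_dest.2 ⟨p, by rw [← h, huy]; exact hy p⟩
  · refine disjoint_left.2 fun z hz hzC => ?_
    simp only [mem_image, mem_univ, true_and] at hz
    obtain ⟨p, rfl⟩ := hz
    simpa [hy p] using hC _ hzC
  · rw [card_image_of_injective _ hinj, card_univ, Fintype.card_fin]

theorem dest_connect {d n m : ℕ} {S : State d n m} {a : Terminal d n}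
    {B : Finset (Terminal d n)} (ha : dest S a = ∅) (hB : ∀ y ∈ B, S y = none)
    (p : Terminal d n → Fin m) (u : Terminal d n) :
    dest (connect S a B p) u = if u = a then B else dest S u := by
  ext y
  by_cases hy : y ∈ B
  · by_cases hu : u = a
    · simp [mem_dest, connect, hy, hu]
    · simp [mem_dest, connect, hy, hu, hB y hy, Ne.symm hu]
  · by_cases hu : u = a
    · simpa [mem_dest, connect, hy, hu] using mt mem_dest.2 (ha ▸ notMem_empty y)
    · simp [mem_dest, connect, hy, hu]

/-- The network is nonblocking as soon as no set of outputs which blocks a window has `m`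
elements. -/
theorem crosstalkFreeNonblocking_of_blocking {d n m f t : ℕ}
    (H : ∀ (a c : Terminal d n) (C Y : Finset (Terminal d n)) (u : Terminal d n → Terminal d n),
      c ∈ C → #C ≤ f → Blocking t f a C Y u → #Y < m) :
    CrosstalkFreeNonblocking d n m f t := by
  intro S hS a B ha hB hBf hfree
  have key : ∀ c ∈ B, ∃ p : Fin m, ∀ b ∈ B, SameWindow t c b →
      ∀ u y, S y = some (u, p) → ¬ SharesSE u y a b := by
    classical
    intro c hc
    by_contra! hcon
    obtain ⟨Y, u, hY, hm⟩ := exists_blocking hS (C := B.filter fun b => SameWindow t c b) ha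
      (fun y hy => hfree y (mem_filter.1 hy).1)
      (fun b hb b' hb' l hl =>
        ((mem_filter.1 hb).2 l hl).symm.trans ((mem_filter.1 hb').2 l hl))
      (fun p => by
        obtain ⟨b, hb, hcb, u, y, hy, hs⟩ := hcon p
        exact ⟨b, mem_filter.2 ⟨hb, hcb⟩, u, y, hy, hs⟩)
    exact (H a c _ Y u (mem_filter.2 ⟨hc, fun _ _ => rfl⟩)
      ((card_le_card (filter_subset _ _)).trans hBf) hY).ne hm
  obtain ⟨c₀, hc₀⟩ := hB
  -- A default plane for windows that B does not meet.
  obtain ⟨p₀, -⟩ := key c₀ hc₀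
  have key' : ∀ z : Terminal d n, ∃ p : Fin m, ∀ b ∈ B, SameWindow t z b →
      ∀ u y, S y = some (u, p) → ¬ SharesSE u y a b := by
    intro z
    by_cases hz : ∃ c ∈ B, SameWindow t z c
    · obtain ⟨c, hc, hzc⟩ := hz
      obtain ⟨p, hp⟩ := key c hc
      exact ⟨p, fun b hb hzb => hp b hb fun l hl => (hzc l hl).symm.trans (hzb l hl)⟩
    · exact ⟨p₀, fun b hb hzb => (hz ⟨b, hb, hzb⟩).elim⟩
  choose P hP using key'
  -- Choosing the plane through the window representative makes the window rule automatic.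
  refine ⟨fun y => P (windowRep c₀ (n - t) y), fun u => ?_, ?_, ?_⟩
  · rw [dest_connect ha hfree]
    split_ifs with h
    · exact hBf
    · exact hS.1 u
  · have hnew : ∀ b ∈ B, ∀ u y, S y = some (u, P (windowRep c₀ (n - t) b)) →
        ¬ SharesSE u y a b := fun b hb =>
      hP _ b hb fun l hl => by simp [windowRep, hl]
    intro y y' u u' p hy hy' hne
    by_cases hyB : y ∈ B <;> by_cases hyB' : y' ∈ B <;>
      simp only [connect, hyB, hyB', if_true, if_false, Option.some.injEq, Prod.mk.injEq] at hy hy'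
    · exact (hne (hy.1.symm.trans hy'.1)).elim
    · obtain ⟨rfl, rfl⟩ := hy
      exact fun h => hnew y hyB u' y' hy' h.symm
    · obtain ⟨rfl, rfl⟩ := hy'
      exact hnew y' hyB' u y hy
    · exact hS.2.1 y y' u u' p hy hy' hne
  · intro y y' u p p' hy hy' hsw
    by_cases hyB : y ∈ B <;> by_cases hyB' : y' ∈ B <;>
      simp only [connect, hyB, hyB', if_true, if_false, Option.some.injEq, Prod.mk.injEq] at hy hy'
    · rw [← hy.2, ← hy'.2, (windowRep_eq_iff c₀ y y').2 hsw]
    · exact (ne_of_dest_eq_empty ha hy' hy.1.symm).elim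
    · exact (ne_of_dest_eq_empty ha hy hy'.1.symm).elim
    · exact hS.2.2 y y' u p p' hy hy' hsw

/-! ### Comparison with G -/

namespace Blocking

variable {d n t f : ℕ} {a c : Terminal d n} {C Y : Finset (Terminal d n)}
  {u : Terminal d n → Terminal d n}

/-- The best choice between the two bounds for the number of blocking outputs in the window itself,
uniformly in the size of the request. -/
theorem card_window_lt (H : Blocking t f a C Y u) (hc : c ∈ C) (hd : 2 ≤ d) (ht : t ≤ n)
    (hnt : n < 2 * t) {s : ℕ} (hs : s ≤ n - t) :
    (#(farPart a c Y u s (n - t)) : ℚ) <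
      (d : ℚ) ^ t - (d : ℚ) ^ (2 * (t : ℤ) - n - 2) * (d - 1) := by
  have hd' : (2 : ℚ) ≤ d := by exact_mod_cast hd
  have h1 := H.card_window_le hc ht s
  have hC : (1 : ℚ) ≤ #C := by exact_mod_cast card_pos.2 ⟨c, hc⟩
  rcases (show n + 1 ≤ 2 * t from hnt).eq_or_lt with h | h
  -- For 2t = n + 1 the subtracted term is 1 - 1/d < 1 ≤ |C|.
  · rw [show 2 * (t : ℤ) - n - 2 = -1 by omega, zpow_neg_one, mul_sub, mul_one,
      inv_mul_cancel₀ (by positivity)]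
    have : 0 < (d : ℚ)⁻¹ := by positivity
    linarith
  · have h2 := H.card_window_le_of_near (c := c) (by omega) (show s ≤ t - 1 by omega)
      (show t - 1 ≤ n by omega)
    obtain ⟨k, rfl⟩ := Nat.exists_eq_add_of_le ht
    obtain ⟨j, rfl⟩ : ∃ j, t = k + 2 + j := ⟨t - (k + 2), by omega⟩
    rw [show 2 * ((k + 2 + j : ℕ) : ℤ) - (k + 2 + j + k : ℕ) - 2 = (j : ℕ) by push_cast; ring,
      zpow_natCast]
    rw [show k + 2 + j + k - (k + 2 + j - 1) = k + 1 by omega,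
      show k + 2 + j - 1 = k + 1 + j by omega] at h2
    have hs1 : (1 : ℚ) ≤ (d : ℚ) ^ s := one_le_pow₀ (by linarith)
    -- With h = t - 1 the two bounds cross near |C| = d^(2t-n-2)(d - 1): one increases with |C|, the
    -- other decreases.
    rcases le_or_gt (#C) (d ^ j * (d - 1)) with hle | hgt
    · have hle' : (#C : ℚ) ≤ (d : ℚ) ^ j * (d - 1) := by
        refine (Nat.cast_le.2 hle).trans_eq ?_
        rw [Nat.cast_mul, Nat.cast_sub (by omega)]
        simp
      have h3 : (#C : ℚ) * ((d : ℚ) ^ (k + 1) - 1) ≤ (d : ℚ) ^ j * (d - 1) * (d ^ (k + 1) - 1) :=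
        mul_le_mul_of_nonneg_right hle' <|
          sub_nonneg.2 (one_le_pow₀ (by linarith))
      have h4 : (d : ℚ) ^ j * (d - 1) * (d ^ (k + 1) - 1) =
        d ^ (k + 2 + j) - d ^ (k + 1 + j) - d ^ j * (d - 1) := by ring
      linarith
    · have hgt' : (d : ℚ) ^ j * (d - 1) < #C := by
        refine Eq.trans_lt ?_ (Nat.cast_lt.2 hgt)
        rw [Nat.cast_mul, Nat.cast_sub (by omega)]
        simp
      linarith

/-- The parameters balance competing terms: s = n - t - r gives f·d^s the order of d^(n-t), h does
so for d^h and f·d^(n-h), and e for f·d^e and d^(n-e). Counting level j separately costs at most (d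
- 1)d^(n-t) and saves (d - 1)d^(n-j-1), which pays up to q = t; so for 2t ≤ n the count stops there,
except in the branch with s = q = e. -/
theorem card_lt_one_add_G (H : Blocking t f a C Y u) (hc : c ∈ C) (hCf : #C ≤ f) (hd : 2 ≤ d)
    (ht : t ≤ n) (hf : f ≤ d ^ n) : (#Y : ℚ) < 1 + G d n t f := by
  have hd1 : 1 ≤ d := by omega
  have hd' : (1 : ℚ) ≤ d := by exact_mod_cast hd1
  have hpow : ∀ i, (1 : ℚ) ≤ (d : ℚ) ^ i := fun i => one_le_pow₀ hd'
  obtain ⟨k, hk⟩ : ∃ k, n - t = k := ⟨_, rfl⟩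
  have hkz : (n : ℤ) - t = (k : ℕ) := by omega
  have hkq : (n : ℚ) - t = k := by exact_mod_cast hkz
  have hC : (1 : ℚ) ≤ #C := by exact_mod_cast card_pos.2 ⟨c, hc⟩
  have hCf' : (#C : ℚ) ≤ f := by exact_mod_cast hCf
  have hwin : ∀ s h : ℕ, s ≤ h → h ≤ n →
      (#(farPart a c Y u s k) : ℚ) ≤ (d : ℚ) ^ h - d ^ s + f * ((d : ℚ) ^ (n - h) - 1) := by
    intro s h hs hh
    have h1 := H.card_window_le_of_near (c := c) hd1 hs hh
    have h2 := mul_le_mul_of_nonneg_right hCf' (sub_nonneg.2 (hpow (n - h)))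
    rw [hk] at h1
    linarith
  have hfull : ∀ s i : ℕ, s + i = k → (#Y : ℚ) ≤ f * ((d : ℚ) ^ s - 1) + i * (d - 1) * d ^ k
      - d ^ k + d ^ s + #(farPart a c Y u s k) := by
    intro s i hsi
    have h := H.card_le_add_farPart hc hd1 s i (by omega)
    rwa [hk, hsi, show k - i = s by omega] at h
  have hpart : ∀ s i : ℕ, s + i ≤ k → (#Y : ℚ) ≤ f * ((d : ℚ) ^ s - 1) + i * (d - 1) * d ^ k
      - d ^ k + d ^ (k - i) + (d ^ (n - (s + i)) - 1) := by
    intro s i hsi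
    have h1 := H.card_le_add_farPart hc hd1 s i (by omega)
    have h2 := H.card_farPart_le hc hd1 s (s + i)
    rw [hk] at h1
    linarith
  obtain ⟨r, hr⟩ : ∃ r, Nat.log d f = r := ⟨_, rfl⟩
  simp only [G, hr, hkz, Int.cast_natCast, hkq, zpow_natCast]
  split_ifs with h1 h2 h3 h4 h5 h6 h7 h8
  -- The term d^0 uses up the 1 in 1 + G, so strictness must come from `card_window_lt`.
  · have e1 := hfull 0 k (by omega)
    have e2 := H.card_window_lt hc hd ht (by omega) (Nat.zero_le _)
    rw [hk] at e2
    simp only [pow_zero] at e1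
    linarith
  · obtain ⟨h, hh⟩ : ∃ h : ℕ, ((r : ℤ) + n + 1) / 2 = (h : ℕ) := ⟨(r + n + 1) / 2, by omega⟩
    obtain ⟨s, hs⟩ : ∃ s : ℕ, (k : ℤ) - r = (s : ℕ) := ⟨k - r, by omega⟩
    obtain ⟨g, hg⟩ : ∃ g : ℕ, (n : ℤ) - h = (g : ℕ) := ⟨n - h, by omega⟩
    have e1 := hfull s r (by omega)
    have e2 := hwin s h (by omega) (by omega)
    rw [show n - h = g by omega] at e2
    simp only [hh, hs, hg, zpow_natCast]
    linarith
  · obtain ⟨h, hh⟩ : ∃ h : ℕ, ((r : ℤ) + n + 1) / 2 = (h : ℕ) := ⟨(r + n + 1) / 2, by omega⟩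
    obtain ⟨g, hg⟩ : ∃ g : ℕ, (n : ℤ) - h = (g : ℕ) := ⟨n - h, by omega⟩
    have e1 := hfull 0 k (by omega)
    have e2 := hwin 0 h (by omega) (by omega)
    rw [show n - h = g by omega] at e2
    simp only [hh, hg, zpow_natCast]
    simp only [pow_zero] at e1 e2
    linarith
  · obtain ⟨s, hs⟩ : ∃ s : ℕ, (k : ℤ) - r = (s : ℕ) := ⟨k - r, by omega⟩
    have e1 := hfull s r (by omega)
    have e2 := H.card_window_lt hc hd ht (by omega) (show s ≤ n - t by omega)
    rw [hk] at e2
    simp only [hs, zpow_natCast]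
    linarith
  · have e1 := hpart 0 k (by omega)
    rw [show n - (0 + k) = t by omega, Nat.sub_self] at e1
    simp only [pow_zero] at e1
    linarith
  · obtain ⟨e, he⟩ : ∃ e : ℕ, ((n : ℤ) - r) / 2 = (e : ℕ) := ⟨(n - r) / 2, by omega⟩
    obtain ⟨g, hg⟩ : ∃ g : ℕ, (n : ℤ) - e = (g : ℕ) := ⟨n - e, by omega⟩
    have e1 := hpart e 0 (by omega)
    rw [show n - (e + 0) = g by omega, Nat.sub_zero] at e1
    simp only [he, hg, zpow_natCast]
    push_cast at e1
    linarith
  -- Here t ≥ 1: for t = 0, f ≤ d^n would already satisfy the condition of the preceding branch.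
  · obtain ⟨t, rfl⟩ : ∃ t', t = t' + 1 := by
      refine ⟨t - 1, ?_⟩
      rcases t with _ | t
      · refine (h6 ⟨h7, ?_⟩).elim
        rw [show (n : ℤ) - 2 * ((0 : ℕ) : ℤ) = (n : ℕ) by simp, zpow_natCast]
        have hf' : (f : ℚ) ≤ (d : ℚ) ^ n := by exact_mod_cast hf
        have hd'' : (2 : ℚ) ≤ d := by exact_mod_cast hd
        exact hf'.trans (le_mul_of_one_le_right (by positivity) (by linarith))
      · rfl
    obtain ⟨j, rfl⟩ : ∃ j, k = j + 1 := ⟨k - 1, by omega⟩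
    have e1 := hpart t 1 (by omega)
    rw [show n - (t + 1) = j + 1 by omega, Nat.add_sub_cancel] at e1
    rw [show ((t + 1 : ℕ) : ℤ) - 1 = (t : ℕ) by omega,
      show ((j + 1 : ℕ) : ℤ) - 1 = (j : ℕ) by omega]
    simp only [zpow_natCast]
    push_cast at e1
    have : (d : ℚ) ^ j * (d ^ 2 - d + 1) = (d - 1) * d ^ (j + 1) + d ^ j := by ring
    linarith
  · obtain ⟨s, hs⟩ : ∃ s : ℕ, (k : ℤ) - r = (s : ℕ) := ⟨k - r, by omega⟩
    obtain ⟨i, hi⟩ : ∃ i : ℕ, 2 * (t : ℤ) - n + r = (i : ℕ) := ⟨2 * t + r - n, by omega⟩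
    obtain ⟨g, hg⟩ : ∃ g : ℕ, 2 * (n : ℤ) - 3 * t - r = (g : ℕ) := ⟨2 * n - 3 * t - r, by omega⟩
    have hiq : 2 * (t : ℚ) - n + r = i := by exact_mod_cast hi
    have e1 := hpart s i (by omega)
    rw [show n - (s + i) = k by omega, show k - i = g by omega] at e1
    simp only [hs, hiq, hg, zpow_natCast]
    linarith
  · obtain ⟨g, hg⟩ : ∃ g : ℕ, (n : ℤ) - 2 * t = (g : ℕ) := ⟨n - 2 * t, by omega⟩
    have e1 := hpart 0 t (by omega)
    rw [show n - (0 + t) = k by omega, show k - t = g by omega] at e1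
    simp only [hg, zpow_natCast]
    simp only [pow_zero] at e1
    linarith

end Blocking

end Multilog

theorem mainTheorem6 (d n t f m : ℕ) (hd : 2 ≤ d) (hn : 1 ≤ n) (ht : t ≤ n)
    (hf : 1 ≤ f) (hfN : f ≤ d ^ n) (hm : 1 + Multilog.G d n t f ≤ (m : ℚ)) :
    Multilog.CrosstalkFreeNonblocking d n m f t :=
  Multilog.crosstalkFreeNonblocking_of_blocking fun _ _ _ _ _ hc hC H => by
    exact_mod_cast (H.card_lt_one_add_G hc hC hd ht hfN).trans_le hm
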